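/- Let $\mathbb{F}$ be an algebraically closed field of characteristic $0$ and let $B$ be a nilpotent $n\times n$ matrix over $\mathbb{F}$. Let $\mathcal{N}_B$ be the set of all nilpotent $n\times n$ matrices $A$ over $\mathbb{F}$ with $AB=BA$. Let $\mathcal{P}(n)$ be the set of all partitions of $n$, and let $\mathcal{P}(\mathcal{N}_B)\subseteq\mathcal{P}(n)$ be the set of all partitions $\mu=(\mu_1\ge\mu_2\ge\dots\ge\mu_s>0)$ of $n$ for which some $A\in\mathcal{N}_B$ has Jordan canonical form with blocks of sizes $\mu_1,\dots,\mu_s$; equivalently, for which $\mathcal{N}_B$ meets the nilpotent orbit $\mathcal{O}_\mu$ of all $n\times n$ matrices similar to the direct sum of the nilpotent Jordan blocks $J_{\mu_1},\dots,J_{\mu_s}$. 1. If $n\le 3$, then $\mathcal{P}(\mathcal{N}_B)=\mathcal{P}(n)$. 2. If $n\ge 4$, then $\mathcal{P}(\mathcal{N}_B)=\mathcal{P}(n)$ if and only if $B^2=0$. -/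

import Mathlib

namespace NilpotentCommutator

/-- The list of the parts of a partition, in nonincreasing order. -/
def partList {n : ℕ} (μ : n.Partition) : List ℕ := μ.parts.sort (· ≥ ·)

theorem sum_partList {n : ℕ} (μ : n.Partition) :
    ∑ i : Fin (partList μ).length, (partList μ).get i = n := by
  have h : (partList μ).sum = n := by
    rw [← Multiset.sum_coe, partList, Multiset.sort_eq, μ.parts_sum]
  exact (Fin.sum_univ_fun_getElem (partList μ) id).trans (by simpa using h)

/-- The identification, in lexicographic order, of the set of pairs
(block, position inside the block) with the set of `n` indices. -/
def blockIndexEquiv {n : ℕ} (μ : n.Partition) :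
    (Σ i : Fin (partList μ).length, Fin ((partList μ).get i)) ≃ Fin n :=
  finSigmaFinEquiv.trans (finCongr (sum_partList μ))

variable (F : Type*) [Field F]

/-- The nilpotent `m × m` Jordan block: ones just above the diagonal, zeros elsewhere. -/
def jordanBlock (m : ℕ) : Matrix (Fin m) (Fin m) F :=
  Matrix.of fun i j => if (i : ℕ) + 1 = (j : ℕ) then 1 else 0

/-- The `n × n` nilpotent matrix in Jordan canonical form given by a partition
`μ₁ ≥ μ₂ ≥ … ≥ μₛ` of `n`: the direct sum of the Jordan blocks of sizes `μ₁, …, μₛ`. -/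
def jordanMatrix {n : ℕ} (μ : n.Partition) : Matrix (Fin n) (Fin n) F :=
  Matrix.reindex (blockIndexEquiv μ) (blockIndexEquiv μ)
    (Matrix.blockDiagonal' fun i => jordanBlock F ((partList μ).get i))

/-- The nilpotent orbit of a partition `μ` of `n`: the set of all `n × n` matrices
with Jordan canonical form `jordanMatrix F μ`. -/
def nilpotentOrbit {n : ℕ} (μ : n.Partition) : Set (Matrix (Fin n) (Fin n) F) :=
  {A | ∃ P : GL (Fin n) F,
    A = (P : Matrix (Fin n) (Fin n) F) * jordanMatrix F μ *
      ((P⁻¹ : GL (Fin n) F) : Matrix (Fin n) (Fin n) F)}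

variable {F}

/-- The nilpotent commutator of `B`: all nilpotent matrices that commute with `B`. -/
def nilpotentCommutator {n : ℕ} (B : Matrix (Fin n) (Fin n) F) :
    Set (Matrix (Fin n) (Fin n) F) :=
  {A | IsNilpotent A ∧ A * B = B * A}

/-- The set of all partitions of `n` that are Jordan types of matrices in the nilpotent
commutator of `B`, that is, whose nilpotent orbits meet the nilpotent commutator of `B`. -/
def commutatorPartitions {n : ℕ} (B : Matrix (Fin n) (Fin n) F) : Set n.Partition :=
  {μ | (nilpotentCommutator B ∩ nilpotentOrbit F μ).Nonempty}

end NilpotentCommutator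

/-!
The Jordan type of an endomorphism is described by cyclic vectors of its Jordan blocks
(`HasJordanType`), and a partition belongs to the nilpotent commutator of `B` exactly when some
endomorphism of that Jordan type commutes with `B` (`mem_commutatorPartitions_iff`).

*If `B ^ 2 = 0`, every partition occurs.* Square-zero endomorphisms are classified up to similarity
by their rank (`exists_linearEquiv_of_mul_self_eq_zero`), so it suffices that every Jordan type of
total size `n` commutes with a square-zero endomorphism of any given rank `k ≤ n / 2`
(`commutesWithSquareZero_of_two_mul_le_sum`). This is additive over direct sums. A single block `A`
of size `d` commutes with `A ^ (d - k)`, which gives all ranks up to `d / 2`. For odd blocks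
rounding loses one half each, and this is regained by an explicit construction for pairs of odd
blocks (`commutesWithSquareZero_pair_self`, `commutesWithSquareZero_pair_odd`).

*If `n ≥ 4` and `B ^ 2 ≠ 0`, one of the partitions `(n)` and `(n - 1, 1)` is missing.* If `B`
commutes with a regular nilpotent `A`, then `B` is a power `A ^ m` times an invertible polynomial
in `A`, which determines the ranks of `B` and `B ^ 2` in terms of `m`
(`HasJordanType.exists_finrank_range_eq_of_commute`). If `B` also commutes with an endomorphism of
type `(n - 1, 1)`, then the action of `B` on the two cyclic vectors bounds the rank of `B` from
above and that of `B ^ 2` from below, incompatibly with those values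
(`HasJordanType.false_of_commute`).

For `n ≤ 3`, either `B ^ 2 = 0`, or `n = 3` and `B` is regular; then `B`, `B ^ 2` and `0` have the
three possible Jordan types.
-/

namespace NilpotentCommutator

open Module Polynomial

universe u

section

variable {F : Type*} [Field F] {V W : Type*} [AddCommGroup V] [Module F V] [AddCommGroup W]
  [Module F W]

/-! ### Jordan types and nilpotent orbits -/

/-- `A` is nilpotent with Jordan blocks of sizes `S`. The multiset `G` lists pairs
`(d, g)` of a block size `d` and a cyclic vector `g` of the block, so that
`g, A g, …, A ^ (d - 1) g` is a Jordan chain and all these chains together span `V`.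
Linear independence is encoded by the equality of dimensions. -/
def HasJordanType (A : End F V) (S : Multiset ℕ) : Prop :=
  ∃ G : Multiset (ℕ × V), G.map Prod.fst = S ∧ (∀ g ∈ G, (A ^ g.1) g.2 = 0) ∧
    Submodule.span F {x | ∃ g ∈ G, ∃ j < g.1, x = (A ^ j) g.2} = ⊤ ∧ finrank F V = S.sum

theorem exists_list_of_map_eq_coe {α β : Type*} (f : α → β) (L : List β) :
    ∀ G : Multiset α, G.map f = L → ∃ l : List α, (l : Multiset α) = G ∧ l.map f = L := by
  induction L with
  | nil => intro G hG; exact ⟨[], by simpa [eq_comm] using hG, rfl⟩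
  | cons x L ih =>
    intro G hG
    have hx : x ∈ G.map f := by rw [hG]; simp
    obtain ⟨y, hy, rfl⟩ := Multiset.mem_map.1 hx
    obtain ⟨G', rfl⟩ := Multiset.exists_cons_of_mem hy
    rw [Multiset.map_cons, ← Multiset.cons_coe, Multiset.cons_inj_right] at hG
    obtain ⟨l, rfl, hl⟩ := ih G' hG
    exact ⟨y :: l, rfl, by simp [hl]⟩

/-- An endomorphism of Jordan type `L` has a basis in which it is the direct sum of Jordan blocks. The
chains are listed from the kernel upwards, to match ones above the diagonal. -/
theorem HasJordanType.exists_basis {A : End F V} {S : Multiset ℕ} (hA : HasJordanType A S)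
    (L : List ℕ) (hL : (L : Multiset ℕ) = S) :
    ∃ b : Basis (Σ i : Fin L.length, Fin (L.get i)) F V, ∀ i (j : Fin (L.get i)),
      A (b ⟨i, j⟩) = if (j : ℕ) = 0 then 0 else b ⟨i, ⟨j - 1, by omega⟩⟩ := by
  obtain ⟨G, hG, h0, hspan, hdim⟩ := hA
  obtain ⟨l, rfl, rfl⟩ := exists_list_of_map_eq_coe Prod.fst L G (hG.trans hL.symm)
  have hlen : ∀ i : Fin (l.map Prod.fst).length, (i : ℕ) < l.length := fun i => by
    simpa using i.2
  let v : (Σ i : Fin (l.map Prod.fst).length, Fin ((l.map Prod.fst).get i)) → V :=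
    fun p => (A ^ ((l.map Prod.fst).get p.1 - 1 - p.2)) (l[(p.1 : ℕ)]'(hlen p.1)).2
  have hv : ⊤ ≤ Submodule.span F (Set.range v) := by
    rw [← hspan, Submodule.span_le]
    rintro x ⟨g, hg, j, hj, rfl⟩
    obtain ⟨i, hi, rfl⟩ := List.getElem_of_mem (Multiset.mem_coe.1 hg)
    refine Submodule.subset_span ⟨⟨⟨i, by simpa using hi⟩, ⟨l[i].1 - 1 - j, ?_⟩⟩, ?_⟩
    · simp only [List.get_eq_getElem, List.getElem_map]; omega
    · have : l[i].1 - 1 - (l[i].1 - 1 - j) = j := by omega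
      simp [v, this]
  have hcard : Fintype.card (Σ i : Fin (l.map Prod.fst).length, Fin ((l.map Prod.fst).get i)) =
      finrank F V := by
    rw [hdim, ← hL, Multiset.sum_coe]
    simpa using Fin.sum_univ_fun_getElem (l.map Prod.fst) id
  refine ⟨basisOfTopLeSpanOfCardEqFinrank v hv hcard, fun i j => ?_⟩
  have hj := j.2
  simp only [coe_basisOfTopLeSpanOfCardEqFinrank, v, ← Module.End.mul_apply, ← pow_succ']
  split_ifs with h
  · have : (l.map Prod.fst).get i - 1 - (j : ℕ) + 1 = (l[(i : ℕ)]'(hlen i)).1 := by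
      rw [h]
      simp only [List.get_eq_getElem, List.getElem_map] at hj ⊢
      omega
    rw [this]
    exact h0 _ (Multiset.mem_coe.2 (List.getElem_mem _))
  · congr 2
    omega

theorem hasJordanType_of_basis {A : End F V} (L : List ℕ)
    (b : Basis (Σ i : Fin L.length, Fin (L.get i)) F V)
    (hb : ∀ i (j : Fin (L.get i)),
      A (b ⟨i, j⟩) = if (j : ℕ) = 0 then 0 else b ⟨i, ⟨j - 1, by omega⟩⟩) :
    HasJordanType A (L : Multiset ℕ) := by
  let w : ∀ i : Fin L.length, V := fun i =>
    if h : 0 < L.get i then b ⟨i, ⟨L.get i - 1, by omega⟩⟩ else 0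
  have hw : ∀ i (k : ℕ) (hk : k < L.get i), (A ^ k) (w i) = b ⟨i, ⟨L.get i - 1 - k, by omega⟩⟩ := by
    intro i k
    induction k with
    | zero => intro hk; simp [w, show 0 < L[(i : ℕ)] from hk]
    | succ k ih =>
      intro hk
      rw [pow_succ', Module.End.mul_apply, ih (by omega), hb, if_neg (by simp only; omega)]
      congr 3
  refine ⟨(Finset.univ : Finset (Fin L.length)).val.map fun i => (L.get i, w i), ?_, ?_, ?_, ?_⟩
  · rw [Multiset.map_map]
    simp only [Function.comp_def, List.get_eq_getElem]
    rw [Fin.univ_val_map]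
    simp
  · intro g hg
    obtain ⟨i, -, rfl⟩ := Multiset.mem_map.1 hg
    by_cases h : 0 < L.get i
    · have h1 := hw i (L.get i - 1) (by omega)
      have h2 : L.get i = L.get i - 1 + 1 := by omega
      simp only
      rw [h2, pow_succ', Module.End.mul_apply, h1, hb, if_pos]
      simp
    · simp only [w, dif_neg h, map_zero]
  · rw [eq_top_iff, ← b.span_eq, Submodule.span_le]
    rintro _ ⟨⟨i, j⟩, rfl⟩
    refine Submodule.subset_span ⟨(L.get i, w i), ?_, L.get i - 1 - j, ?_, ?_⟩
    · exact Multiset.mem_map.2 ⟨i, by simp, rfl⟩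
    · have := j.2; simp only; omega
    · rw [hw i _ (by omega)]
      congr 2
      ext
      have := j.2
      simp only; omega
  · rw [finrank_eq_card_basis b]
    simp

theorem HasJordanType.conj {A : End F V} {S : Multiset ℕ} (hA : HasJordanType A S)
    {A' : End F W} (φ : V ≃ₗ[F] W) (h : ∀ x, A' (φ x) = φ (A x)) : HasJordanType A' S := by
  obtain ⟨G, hG, h0, hspan, hdim⟩ := hA
  have hp : ∀ k x, (A' ^ k) (φ x) = φ ((A ^ k) x) := by
    intro k
    induction k with
    | zero => simp
    | succ k ih => intro x; rw [pow_succ, pow_succ, Module.End.mul_apply, h, ih]; rfl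
  refine ⟨G.map fun g => (g.1, φ g.2), by simpa [Multiset.map_map] using hG, ?_, ?_, ?_⟩
  · intro g hg
    obtain ⟨g', hg', rfl⟩ := Multiset.mem_map.1 hg
    simp [hp, h0 g' hg']
  · rw [eq_top_iff, ← LinearMap.range_eq_top.2 φ.surjective, ← Submodule.map_top, ← hspan,
      Submodule.map_span, Submodule.span_le]
    rintro _ ⟨_, ⟨g, hg, j, hj, rfl⟩, rfl⟩
    refine Submodule.subset_span ⟨(g.1, φ g.2), Multiset.mem_map_of_mem _ hg, j, hj, ?_⟩
    simp [hp]
  · rw [← hdim, φ.finrank_eq]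

theorem HasJordanType.prod [FiniteDimensional F V] [FiniteDimensional F W]
    {A : End F V} {S : Multiset ℕ} (hA : HasJordanType A S)
    {A' : End F W} {S' : Multiset ℕ} (hA' : HasJordanType A' S') :
    HasJordanType (A.prodMap A' : End F (V × W)) (S + S') := by
  obtain ⟨G, hG, h0, hspan, hdim⟩ := hA
  obtain ⟨G', hG', h0', hspan', hdim'⟩ := hA'
  have hp : ∀ k x, ((A.prodMap A' : End F (V × W)) ^ k) x = ((A ^ k) x.1, (A' ^ k) x.2) := by
    intro k x
    induction k with
    | zero => rfl
    | succ k ih => rw [pow_succ', Module.End.mul_apply, ih, pow_succ', pow_succ']; rfl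
  refine ⟨G.map (fun g => (g.1, (g.2, 0))) + G'.map (fun g => (g.1, (0, g.2))), ?_, ?_, ?_, ?_⟩
  · simp [Multiset.map_map, ← hG, ← hG']
  · intro g hg
    rcases Multiset.mem_add.1 hg with hg | hg <;>
    obtain ⟨g', hg', rfl⟩ := Multiset.mem_map.1 hg
    · simp [hp, h0 g' hg']
    · simp [hp, h0' g' hg']
  · rw [eq_top_iff, ← LinearMap.sup_range_inl_inr]
    refine sup_le ?_ ?_
    · rw [LinearMap.range_eq_map, ← hspan, Submodule.map_span, Submodule.span_le]
      rintro _ ⟨_, ⟨g, hg, j, hj, rfl⟩, rfl⟩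
      refine Submodule.subset_span ⟨(g.1, (g.2, 0)),
        Multiset.mem_add.2 (Or.inl (Multiset.mem_map.2 ⟨g, hg, rfl⟩)), j, hj, ?_⟩
      simp [hp]
    · rw [LinearMap.range_eq_map, ← hspan', Submodule.map_span, Submodule.span_le]
      rintro _ ⟨_, ⟨g, hg, j, hj, rfl⟩, rfl⟩
      refine Submodule.subset_span ⟨(g.1, (0, g.2)),
        Multiset.mem_add.2 (Or.inr (Multiset.mem_map.2 ⟨g, hg, rfl⟩)), j, hj, ?_⟩
      simp [hp]
  · rw [finrank_prod, hdim, hdim', Multiset.sum_add]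

theorem HasJordanType.isNilpotent {A : End F V} {S : Multiset ℕ} (hA : HasJordanType A S) :
    IsNilpotent A := by
  obtain ⟨G, hG, h0, hspan, hdim⟩ := hA
  refine ⟨S.sum, LinearMap.ext_on_range (v := fun x : {x | ∃ g ∈ G, ∃ j < g.1, x = (A ^ j) g.2} =>
    (x : V)) (by simpa using hspan) ?_⟩
  rintro ⟨_, g, hg, j, hj, rfl⟩
  have hle : g.1 ≤ S.sum := Multiset.single_le_sum (fun _ _ => Nat.zero_le _) _
    (hG ▸ Multiset.mem_map_of_mem _ hg)
  obtain ⟨k, hk⟩ := Nat.exists_eq_add_of_le' hle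
  rw [← Module.End.mul_apply, ← pow_add, add_comm, pow_add, Module.End.mul_apply, hk, pow_add,
    Module.End.mul_apply, h0 g hg]
  simp

/-- A basis brings `A` to Jordan form exactly when `A` shifts each of its chains down by one step. -/
theorem toMatrix_eq_blockDiagonal'_iff {A : End F V} (L : List ℕ)
    (b : Basis (Σ i : Fin L.length, Fin (L.get i)) F V) :
    LinearMap.toMatrix b b A = Matrix.blockDiagonal' (fun i => jordanBlock F (L.get i)) ↔
      ∀ i (j : Fin (L.get i)),
        A (b ⟨i, j⟩) = if (j : ℕ) = 0 then 0 else b ⟨i, ⟨j - 1, by omega⟩⟩ := by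
  have key : ∀ i (j : Fin (L.get i)) (p : Σ i : Fin L.length, Fin (L.get i)),
      Matrix.blockDiagonal' (fun i => jordanBlock F (L.get i)) p ⟨i, j⟩ =
        b.repr (if (j : ℕ) = 0 then 0 else b ⟨i, ⟨j - 1, by omega⟩⟩) p := by
    rintro i j ⟨i', j'⟩
    by_cases hi : i' = i
    · subst hi
      rw [Matrix.blockDiagonal'_apply_eq, jordanBlock, Matrix.of_apply]
      split_ifs with h1 h2 h2
      · omega
      · rw [b.repr_self, Finsupp.single_apply, if_pos]
        congr 1
        ext
        simp only; omega
      · simp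
      · rw [b.repr_self, Finsupp.single_apply, if_neg]
        intro h
        have := congrArg Fin.val (eq_of_heq (Sigma.mk.inj h).2)
        simp only at this; omega
    · rw [Matrix.blockDiagonal'_apply_ne _ _ _ hi]
      split_ifs
      · simp
      · rw [b.repr_self, Finsupp.single_apply, if_neg]
        intro h
        exact hi (Sigma.mk.inj h).1.symm
  constructor
  · intro h i j
    apply b.repr.injective
    ext p
    rw [← key, ← h, LinearMap.toMatrix_apply]
  · intro h
    ext p ⟨i, j⟩
    rw [LinearMap.toMatrix_apply, h, key]

theorem coe_partList {n : ℕ} (μ : n.Partition) : (partList μ : Multiset ℕ) = μ.parts :=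
  Multiset.sort_eq _ _

theorem mem_nilpotentOrbit_iff {n : ℕ} (μ : n.Partition) (A : Matrix (Fin n) (Fin n) F) :
    A ∈ nilpotentOrbit F μ ↔ HasJordanType (Matrix.toLin' A) μ.parts := by
  constructor
  · rintro ⟨P, hP⟩
    rw [← coe_partList]
    let c : Basis (Fin n) F (Fin n → F) := (Pi.basisFun F (Fin n)).map
      (LinearMap.GeneralLinearGroup.generalLinearEquiv F _ (Matrix.GeneralLinearGroup.toLin P))
    refine hasJordanType_of_basis (partList μ) (c.reindex (blockIndexEquiv μ).symm)
      ((toMatrix_eq_blockDiagonal'_iff _ _).1 ?_)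
    have hc : LinearMap.toMatrix c c (Matrix.toLin' A) = jordanMatrix F μ := by
      have h1 : LinearMap.toMatrix c c (Matrix.toLin' A) =
        c.toMatrix (Pi.basisFun F (Fin n)) * A * (Pi.basisFun F (Fin n)).toMatrix c := by
        rw [← basis_toMatrix_mul_linearMap_toMatrix_mul_basis_toMatrix c (Pi.basisFun F (Fin n)) c
          (Pi.basisFun F (Fin n)), LinearMap.toMatrix_eq_toMatrix', LinearMap.toMatrix'_toLin']
      have h2 : (Pi.basisFun F (Fin n)).toMatrix c = P := by
        ext i j
        simp [Basis.toMatrix_apply, c]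
      have h3 : c.toMatrix (Pi.basisFun F (Fin n)) * (P : Matrix (Fin n) (Fin n) F) = 1 := by
        rw [← h2, Basis.toMatrix_mul_toMatrix_flip]
      have h4 : c.toMatrix (Pi.basisFun F (Fin n)) = ((P⁻¹ : GL (Fin n) F) : Matrix _ _ F) := by
        rw [← mul_one (c.toMatrix _), ← P.mul_inv, ← mul_assoc, h3, one_mul]
      rw [h1, h2, h4, hP, ← mul_assoc, ← mul_assoc, P.inv_mul, one_mul, mul_assoc, P.inv_mul,
        mul_one]
    ext p q
    have := congrFun (congrFun hc (blockIndexEquiv μ p)) (blockIndexEquiv μ q)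
    simpa [LinearMap.toMatrix_apply, jordanMatrix] using this
  · intro h
    obtain ⟨b, hb⟩ := h.exists_basis (partList μ) (coe_partList μ)
    rw [← toMatrix_eq_blockDiagonal'_iff] at hb
    let c := b.reindex (blockIndexEquiv μ)
    let P : GL (Fin n) F := ⟨(Pi.basisFun F (Fin n)).toMatrix c, c.toMatrix (Pi.basisFun F (Fin n)),
      Basis.toMatrix_mul_toMatrix_flip _ _, Basis.toMatrix_mul_toMatrix_flip _ _⟩
    refine ⟨P, ?_⟩
    have hc : LinearMap.toMatrix c c (Matrix.toLin' A) = jordanMatrix F μ := by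
      ext p q
      have := congrFun (congrFun hb ((blockIndexEquiv μ).symm p)) ((blockIndexEquiv μ).symm q)
      simpa [LinearMap.toMatrix_apply, jordanMatrix, c] using this
    change A = (Pi.basisFun F (Fin n)).toMatrix c * _ * c.toMatrix (Pi.basisFun F (Fin n))
    rw [← hc, basis_toMatrix_mul_linearMap_toMatrix_mul_basis_toMatrix,
      LinearMap.toMatrix_eq_toMatrix', LinearMap.toMatrix'_toLin']

/-! ### Regular nilpotent endomorphisms -/

theorem HasJordanType.exists_cyclic {A : End F V} {d : ℕ} (hA : HasJordanType A {d}) :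
    ∃ g : V, (A ^ d) g = 0 ∧ Submodule.span F (Set.range fun i : Fin d => (A ^ (i : ℕ)) g) = ⊤ ∧
      finrank F V = d := by
  obtain ⟨G, hG, h0, hspan, hdim⟩ := hA
  obtain ⟨g, rfl, rfl⟩ := Multiset.map_eq_singleton.1 hG
  refine ⟨g.2, h0 g (by simp), ?_, by simpa using hdim⟩
  rw [eq_top_iff, ← hspan, Submodule.span_le]
  rintro _ ⟨g', hg', j, hj, rfl⟩
  obtain rfl := Multiset.mem_singleton.1 hg'
  exact Submodule.subset_span ⟨⟨j, hj⟩, rfl⟩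

theorem HasJordanType.finrank_range_pow {A : End F V} {d : ℕ} (hA : HasJordanType A {d}) (m : ℕ) :
    finrank F (LinearMap.range (A ^ m)) = d - m := by
  obtain ⟨g, h0, hspan, hdim⟩ := hA.exists_cyclic
  have h0' : ∀ i, d ≤ i → (A ^ i) g = 0 := by
    intro i hi
    obtain ⟨k, rfl⟩ := Nat.exists_eq_add_of_le' hi
    rw [pow_add, Module.End.mul_apply, h0, map_zero]
  have hli : LinearIndependent F fun i : Fin d => (A ^ (i : ℕ)) g :=
    linearIndependent_of_top_le_span_of_card_eq_finrank hspan.ge (by simp [hdim])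
  have hli' := hli.comp (fun i : Fin (d - m) => (⟨m + i, by omega⟩ : Fin d)) (by
    intro i j h
    simpa [Fin.ext_iff] using h)
  have hr : LinearMap.range (A ^ m) =
      Submodule.span F (Set.range fun i : Fin (d - m) => (A ^ (m + i : ℕ)) g) := by
    rw [LinearMap.range_eq_map, ← hspan, Submodule.map_span]
    apply le_antisymm
    · rw [Submodule.span_le]
      rintro _ ⟨_, ⟨i, rfl⟩, rfl⟩
      simp only [← Module.End.mul_apply, ← pow_add]
      by_cases h : m + i < d
      · exact Submodule.subset_span ⟨⟨i, by omega⟩, rfl⟩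
      · rw [h0' _ (by omega)]
        exact Submodule.zero_mem _
    · rw [Submodule.span_le]
      rintro _ ⟨i, rfl⟩
      refine Submodule.subset_span ⟨_, ⟨⟨i, by omega⟩, rfl⟩, ?_⟩
      simp only [← Module.End.mul_apply, ← pow_add]
  rw [hr]
  exact (finrank_span_eq_card hli').trans (Fintype.card_fin _)

/-! ### Similarity of square-zero endomorphisms -/

theorem sumExtend_apply_inl {ι : Type*} {v : ι → V} (hs : LinearIndependent F v) (i : ι) :
    Basis.sumExtend hs (Sum.inl i) = v i := by
  simp only [Basis.sumExtend, Basis.reindex_apply]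
  exact Basis.extend_apply_self _ _

/-- A square-zero endomorphism maps a complement of its kernel isomorphically onto its range, which
lies in the kernel. -/
theorem exists_basis_of_mul_self_eq_zero [FiniteDimensional F V] (N : End F V) (hN : N * N = 0)
    {k : ℕ} (hk : finrank F (LinearMap.range N) = k) :
    ∃ (m : ℕ) (b : Basis ((Fin k ⊕ Fin m) ⊕ Fin k) F V),
      (∀ i, N (b (Sum.inl i)) = 0) ∧ ∀ i, N (b (Sum.inr i)) = b (Sum.inl (Sum.inl i)) := by
  obtain ⟨C, hC⟩ := Submodule.exists_isCompl (LinearMap.ker N)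
  have hdim : finrank F C = k := by
    have h1 := Submodule.finrank_add_eq_of_isCompl hC
    have h2 := LinearMap.finrank_range_add_finrank_ker N
    omega
  let c : Basis (Fin k) F C := finBasisOfFinrankEq F C hdim
  have hmem : ∀ x, N x ∈ LinearMap.ker N := fun x => by
    rw [LinearMap.mem_ker, ← Module.End.mul_apply, hN, LinearMap.zero_apply]
  let f : C →ₗ[F] LinearMap.ker N := (N.codRestrict _ hmem).comp C.subtype
  have hf : LinearMap.ker f = ⊥ := by
    rw [LinearMap.ker_eq_bot']
    intro x hx
    have hx' : N x = 0 := congrArg Subtype.val hx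
    exact Subtype.ext (Submodule.disjoint_def.1 hC.disjoint _ hx' x.2)
  have hli := c.linearIndependent.map' f hf
  let d := Basis.sumExtend hli
  have : Fintype (Basis.sumExtendIndex hli) :=
    @Fintype.sumRight _ _ (FiniteDimensional.fintypeBasisIndex d)
  let e := (d.reindex (Equiv.sumCongr (Equiv.refl _) (Fintype.equivFin _))).prod c
  refine ⟨_, e.map (Submodule.prodEquivOfIsCompl _ _ hC), ?_, ?_⟩
  · intro i
    simp [e]
  · intro i
    have h1 : (d (Sum.inl i) : V) = N (c i) := by
      rw [sumExtend_apply_inl]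
      rfl
    simp [e, h1]

theorem exists_linearEquiv_of_mul_self_eq_zero [FiniteDimensional F V] [FiniteDimensional F W]
    {N : End F V} (hN : N * N = 0) {N' : End F W} (hN' : N' * N' = 0)
    (hdim : finrank F V = finrank F W)
    (hrank : finrank F (LinearMap.range N) = finrank F (LinearMap.range N')) :
    ∃ φ : V ≃ₗ[F] W, ∀ x, φ (N x) = N' (φ x) := by
  obtain ⟨m, b, hb0, hb1⟩ := exists_basis_of_mul_self_eq_zero N hN hrank
  obtain ⟨m', b', hb0', hb1'⟩ := exists_basis_of_mul_self_eq_zero N' hN' rfl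
  have hm : m = m' := by
    rw [finrank_eq_card_basis b, finrank_eq_card_basis b'] at hdim
    simp only [Fintype.card_sum, Fintype.card_fin] at hdim
    omega
  subst hm
  refine ⟨b.equiv b' (Equiv.refl _), fun x => ?_⟩
  have h : (b.equiv b' (Equiv.refl _)).toLinearMap ∘ₗ N =
      N' ∘ₗ (b.equiv b' (Equiv.refl _)).toLinearMap := by
    refine b.ext ?_
    rintro (i | i) <;> simp [hb0, hb0', hb1, hb1']
  exact LinearMap.congr_fun h x

end

section

variable {F : Type u} [Field F]

/-! ### Jordan types commuting with a square-zero endomorphism -/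

/-- Some endomorphism of Jordan type `S` of a finite-dimensional space commutes with a square-zero
endomorphism of rank `k`. -/
def CommutesWithSquareZero (F : Type u) [Field F] (S : Multiset ℕ) (k : ℕ) : Prop :=
  ∃ (V : Type u) (_ : AddCommGroup V) (_ : Module F V) (_ : FiniteDimensional F V) (A B : End F V),
    A * B = B * A ∧ B * B = 0 ∧ finrank F (LinearMap.range B) = k ∧ HasJordanType A S


theorem finrank_range_prodMap {V W : Type*} [AddCommGroup V] [Module F V] [AddCommGroup W]
    [Module F W] [FiniteDimensional F V] [FiniteDimensional F W] (B : End F V) (B' : End F W) :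
    finrank F (LinearMap.range (B.prodMap B')) =
      finrank F (LinearMap.range B) + finrank F (LinearMap.range B') := by
  have h := LinearMap.finrank_range_of_inj (f := (LinearMap.range B).subtype.prodMap
    (LinearMap.range B').subtype) (Subtype.val_injective.prodMap Subtype.val_injective)
  rw [LinearMap.range_prodMap, Submodule.range_subtype, Submodule.range_subtype] at h
  rw [LinearMap.range_prodMap, h, finrank_prod]

theorem CommutesWithSquareZero.add {S S' : Multiset ℕ} {k k' : ℕ}
    (h : CommutesWithSquareZero F S k) (h' : CommutesWithSquareZero F S' k') :
    CommutesWithSquareZero F (S + S') (k + k') := by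
  obtain ⟨V, _, _, _, A, B, hAB, hB, hk, hA⟩ := h
  obtain ⟨V', _, _, _, A', B', hAB', hB', hk', hA'⟩ := h'
  refine ⟨V × V', inferInstance, inferInstance, inferInstance, A.prodMap A', B.prodMap B',
    ?_, ?_, ?_, hA.prod hA'⟩
  · exact LinearMap.ext fun p =>
      Prod.ext (LinearMap.congr_fun hAB p.1) (LinearMap.congr_fun hAB' p.2)
  · exact LinearMap.ext fun p =>
      Prod.ext (LinearMap.congr_fun hB p.1) (LinearMap.congr_fun hB' p.2)
  · rw [finrank_range_prodMap, hk, hk']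

theorem exists_hasJordanType_singleton (d : ℕ) :
    ∃ A : End F (Fin d → F), HasJordanType A {d} := by
  let w : ℕ → Fin d → F := fun i => if h : i < d then Pi.single ⟨i, h⟩ 1 else 0
  let A : End F (Fin d → F) := (Pi.basisFun F (Fin d)).constr F fun i => w (i + 1)
  have hA : ∀ i, A (w i) = w (i + 1) := by
    intro i
    by_cases h : i < d
    · have := (Pi.basisFun F (Fin d)).constr_basis F (fun i => w (i + 1)) ⟨i, h⟩
      rw [Pi.basisFun_apply] at this
      simp only [A]
      conv_lhs => simp only [w, dif_pos h]
      exact this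
    · simp [w, h, show ¬ i + 1 < d by omega]
  have hp : ∀ i, (A ^ i) (w 0) = w i := by
    intro i
    induction i with
    | zero => rfl
    | succ i ih => rw [pow_succ', Module.End.mul_apply, ih, hA]
  refine ⟨A, {(d, w 0)}, by simp, ?_, ?_, by simp⟩
  · intro g hg
    obtain rfl := Multiset.mem_singleton.1 hg
    rw [hp]
    simp [w]
  · rw [eq_top_iff, ← (Pi.basisFun F (Fin d)).span_eq, Submodule.span_le]
    rintro _ ⟨i, rfl⟩
    refine Submodule.subset_span ⟨_, Multiset.mem_singleton_self _, i, i.2, ?_⟩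
    simp [hp, w]

theorem commutesWithSquareZero_singleton {d k : ℕ} (h : 2 * k ≤ d) :
    CommutesWithSquareZero F {d} k := by
  obtain ⟨A, hA⟩ := exists_hasJordanType_singleton (F := F) d
  refine ⟨_, inferInstance, inferInstance, inferInstance, A, A ^ (d - k), ?_, ?_, ?_, hA⟩
  · rw [← pow_succ, ← pow_succ']
  · rw [← pow_add, ← LinearMap.range_eq_bot, ← Submodule.finrank_eq_zero (R := F),
      hA.finrank_range_pow]
    omega
  · rw [hA.finrank_range_pow]
    omega

theorem finrank_range_inr_comp_fst {W : Type*} [AddCommGroup W] [Module F W] :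
    finrank F (LinearMap.range ((LinearMap.inr F W W).comp (LinearMap.fst F W W))) =
      finrank F W := by
  rw [LinearMap.range_comp_of_range_eq_top _ (LinearMap.range_eq_top.2 LinearMap.fst_surjective)]
  exact LinearMap.finrank_range_of_inj LinearMap.inr_injective

/-- On a product of two equal blocks, the map `(x, y) ↦ (0, x)` is square-zero and commutes with the
two shifts. -/
theorem commutesWithSquareZero_pair_self (d : ℕ) : CommutesWithSquareZero F {d, d} d := by
  obtain ⟨A, hA⟩ := exists_hasJordanType_singleton (F := F) d
  refine ⟨_, inferInstance, inferInstance, inferInstance, A.prodMap A,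
    (LinearMap.inr F _ _).comp (LinearMap.fst F _ _), ?_, ?_, ?_, hA.prod hA⟩
  · ext <;> simp
  · ext <;> simp
  · rw [finrank_range_inr_comp_fst]
    simp

/-- The spanning vectors `x i`, `x' i` for `i ≤ a` and `y j`, `y' j` for `j < b` are moved by `A`
along `x 0, …, x a, x' 1 - y' 0, x' 2 - y' 1, …` and along `u = y 0, …, y (b - 1), x' 0, x' 1, …`.
The two chains meet; the second Jordan block is generated by `u - A ^ (a - b) (x 0)`. If `b = 0`,
then `u = x' 0`. -/
theorem hasJordanType_pair {V : Type*} [AddCommGroup V] [Module F V] {A : End F V} {a b : ℕ}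
    (hab : b < a) (x y x' y' : ℕ → V) (u : V) (hx : ∀ i < a, A (x i) = x (i + 1))
    (hxa : A (x a) = x' 1 - y' 0) (hx' : ∀ i, A (x' i) = x' (i + 1))
    (hy' : ∀ i, A (y' i) = y' (i + 1)) (hx0 : x' (a + 1) = 0) (hy0 : ∀ j, b ≤ j → y' j = 0)
    (hu : ∀ j < b, (A ^ j) u = y j) (hub : (A ^ b) u = x' 0)
    (hspan : ∀ S : Submodule F V, (∀ i ≤ a, x i ∈ S) → (∀ i ≤ a, x' i ∈ S) → (∀ j < b, y j ∈ S) →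
      (∀ j < b, y' j ∈ S) → S = ⊤) (hdim : finrank F V = 2 * (a + b + 1)) :
    HasJordanType A {2 * a + 1, 2 * b + 1} := by
  have hx'p : ∀ i, (A ^ i) (x' 0) = x' i := by
    intro i
    induction i with
    | zero => rfl
    | succ i ih => rw [pow_succ', Module.End.mul_apply, ih, hx']
  have hup : ∀ i, (A ^ (b + i)) u = x' i := by
    intro i
    rw [add_comm, pow_add, Module.End.mul_apply, hub, hx'p]
  have hxp : ∀ i ≤ a, (A ^ i) (x 0) = x i := by
    intro i
    induction i with
    | zero => intro _; rfl
    | succ i ih => intro hi; rw [pow_succ', Module.End.mul_apply, ih (by omega), hx i (by omega)]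
  have hxp' : ∀ i, (A ^ (a + 1 + i)) (x 0) = x' (i + 1) - y' i := by
    intro i
    induction i with
    | zero => rw [add_zero, pow_succ', Module.End.mul_apply, hxp a le_rfl, hxa]
    | succ i ih => rw [← add_assoc, pow_succ', Module.End.mul_apply, ih, map_sub, hx', hy']
  let f : V := u - (A ^ (a - b)) (x 0)
  have hf : ∀ i, (A ^ i) f = (A ^ i) u - (A ^ (a - b + i)) (x 0) := by
    intro i
    rw [map_sub, ← Module.End.mul_apply, ← pow_add, add_comm i]
  have hfp : ∀ i, (A ^ (b + 1 + i)) f = y' i := by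
    intro i
    rw [hf, show a - b + (b + 1 + i) = a + 1 + i by omega, hxp',
      show b + 1 + i = b + (i + 1) by omega, hup]
    abel
  have he0 : (A ^ (2 * a + 1)) (x 0) = 0 := by
    rw [show 2 * a + 1 = a + 1 + a by omega, hxp', hx0, hy0 a (by omega), sub_zero]
  have hf0 : (A ^ (2 * b + 1)) f = 0 := by
    rw [show 2 * b + 1 = b + 1 + b by omega, hfp, hy0 b le_rfl]
  refine ⟨{(2 * a + 1, x 0), (2 * b + 1, f)}, by simp, ?_, ?_, ?_⟩
  · intro g hg
    simp only [Multiset.insert_eq_cons, Multiset.mem_cons, Multiset.mem_singleton] at hg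
    rcases hg with rfl | rfl
    exacts [he0, hf0]
  · set S := Submodule.span F {z | ∃ g ∈ ({(2 * a + 1, x 0), (2 * b + 1, f)} : Multiset (ℕ × V)),
      ∃ j < g.1, z = (A ^ j) g.2} with hS
    have hmem : ∀ g ∈ ({(2 * a + 1, x 0), (2 * b + 1, f)} : Multiset (ℕ × V)),
        (A ^ g.1) g.2 = 0 → ∀ j, (A ^ j) g.2 ∈ S := by
      intro g hg h0 j
      by_cases hj : j < g.1
      · exact Submodule.subset_span ⟨g, hg, j, hj, rfl⟩
      · obtain ⟨k, rfl⟩ := Nat.exists_eq_add_of_le' (not_lt.1 hj)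
        rw [pow_add, Module.End.mul_apply, h0, map_zero]
        exact S.zero_mem
    have he : ∀ j, (A ^ j) (x 0) ∈ S := hmem (2 * a + 1, x 0) (by simp) he0
    have hfS : ∀ j, (A ^ j) f ∈ S := hmem (2 * b + 1, f) (by simp) hf0
    have huS : ∀ j, (A ^ j) u ∈ S := by
      intro j
      have := S.add_mem (hfS j) (he (a - b + j))
      rwa [hf, sub_add_cancel] at this
    refine hspan S ?_ ?_ ?_ ?_
    · intro i hi
      rw [← hxp i hi]
      exact he i
    · intro i _
      rw [← hup]
      exact huS _
    · intro j hj
      rw [← hu j hj]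
      exact huS j
    · intro j _
      rw [← hfp]
      exact hfS _
  · rw [hdim]
    simp
    ring

/-- Two blocks of distinct odd sizes `2 * a + 1` and `2 * b + 1` admit a commuting square-zero
endomorphism of rank `a + b + 1`, one more than the sum of the largest ranks on the single blocks.

The space is `W × W`, thought of as `W` with coefficients in the dual numbers, and the
square-zero map `(x, y) ↦ (0, x)` is the multiplication by `ε`. A map commuting with it has the
form `A₀ + ε A₁`; here `A₀` has the two chains `w 0, …, w a` and `v 0, …, v (b - 1)`, and `A₁` links
their ends to the `ε`-part by `w a ↦ w 1 - v 0` and `v (b - 1) ↦ w 0`. -/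
theorem commutesWithSquareZero_pair_odd {a b : ℕ} (hab : b < a) :
    CommutesWithSquareZero F {2 * a + 1, 2 * b + 1} (a + b + 1) := by
  let ι := Fin (a + 1) ⊕ Fin b
  let β := Pi.basisFun F ι
  let w : ℕ → ι → F := fun i => if h : i < a + 1 then β (Sum.inl ⟨i, h⟩) else 0
  let v : ℕ → ι → F := fun j => if h : j < b then β (Sum.inr ⟨j, h⟩) else 0
  let A₀ : End F (ι → F) :=
    β.constr F (Sum.elim (fun i => w (i + 1)) (fun j => v (j + 1)))
  let A₁ : End F (ι → F) :=
    β.constr F (Sum.elim (fun i => if (i : ℕ) = a then w 1 - v 0 else 0)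
      (fun j => if (j : ℕ) + 1 = b then w 0 else 0))
  have hw : ∀ i (h : i < a + 1), w i = β (Sum.inl ⟨i, h⟩) := fun i h => dif_pos h
  have hv : ∀ j (h : j < b), v j = β (Sum.inr ⟨j, h⟩) := fun j h => dif_pos h
  have hw0 : ∀ i, a < i → w i = 0 := fun i h => dif_neg (by omega)
  have hv0 : ∀ j, b ≤ j → v j = 0 := fun j h => dif_neg (by omega)
  have hA₀w : ∀ i, A₀ (w i) = w (i + 1) := by
    intro i
    by_cases h : i < a + 1
    · rw [hw i h, Basis.constr_basis, Sum.elim_inl]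
    · rw [hw0 i (by omega), hw0 (i + 1) (by omega), map_zero]
  have hA₀v : ∀ j, A₀ (v j) = v (j + 1) := by
    intro j
    by_cases h : j < b
    · rw [hv j h, Basis.constr_basis, Sum.elim_inr]
    · rw [hv0 j (by omega), hv0 (j + 1) (by omega), map_zero]
  have hA₁w : ∀ i ≤ a, A₁ (w i) = if i = a then w 1 - v 0 else 0 := by
    intro i h
    rw [hw i (by omega), Basis.constr_basis, Sum.elim_inl]
  have hA₁v : ∀ j < b, A₁ (v j) = if j + 1 = b then w 0 else 0 := by
    intro j h
    rw [hv j h, Basis.constr_basis, Sum.elim_inr]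
  let A : End F ((ι → F) × (ι → F)) :=
    (A₀.comp (LinearMap.fst F _ _)).prod
      (A₁.comp (LinearMap.fst F _ _) + A₀.comp (LinearMap.snd F _ _))
  have hA : ∀ p q, A (p, q) = (A₀ p, A₁ p + A₀ q) := fun p q => rfl
  refine ⟨(ι → F) × (ι → F), inferInstance, inferInstance, inferInstance, A,
    (LinearMap.inr F _ _).comp (LinearMap.fst F _ _), ?_, ?_, ?_, ?_⟩
  · refine LinearMap.ext fun p => ?_
    simp [A]
  · ext <;> simp
  · rw [finrank_range_inr_comp_fst]
    simp [ι]
    ring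
  · have hp : ∀ j < b, (A ^ j) (v 0, 0) = (v j, 0) := by
      intro j
      induction j with
      | zero => intro _; rfl
      | succ j ih =>
        intro h
        rw [pow_succ', Module.End.mul_apply, ih (by omega), hA, hA₀v, hA₁v j (by omega),
          if_neg (by omega), map_zero, add_zero]
    refine hasJordanType_pair hab (fun i => (w i, 0)) (fun j => (v j, 0)) (fun i => (0, w i))
      (fun j => (0, v j)) (if b = 0 then (0, w 0) else (v 0, 0)) ?_ ?_ ?_ ?_ ?_ ?_ ?_ ?_ ?_ ?_
    · intro i hi
      rw [hA, hA₀w, hA₁w i hi.le, if_neg hi.ne, map_zero, add_zero]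
    · rw [hA, hA₀w, hA₁w a le_rfl, if_pos rfl, hw0 (a + 1) (by omega)]
      simp
    · intro i
      simp [hA, hA₀w]
    · intro i
      simp [hA, hA₀v]
    · simp [hw0]
    · intro j hj
      simp [hv0 j hj]
    · intro j hj
      rw [if_neg (by omega), hp j hj]
    · split_ifs with h
      · subst h
        rfl
      · obtain ⟨c, rfl⟩ : ∃ c, b = c + 1 := ⟨b - 1, by omega⟩
        rw [pow_succ', Module.End.mul_apply, hp c (by omega), hA, hA₀v, hA₁v c (by omega),
          if_pos rfl, hv0 _ le_rfl, map_zero, add_zero]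
    · intro S h1 h2 h3 h4
      rw [eq_top_iff, ← (β.prod β).span_eq, Submodule.span_le]
      rintro _ ⟨(⟨i, hi⟩ | ⟨j, hj⟩) | (⟨i, hi⟩ | ⟨j, hj⟩), rfl⟩
      · simpa [hw i hi] using h1 i (by omega)
      · simpa [hv j hj] using h3 j hj
      · simpa [hw i hi] using h2 i (by omega)
      · simpa [hv j hj] using h4 j hj
    · simp [ι]
      ring

/-- The rank bound `2 * k ≤ dim` is the only obstruction. Single blocks of size `d` contribute any
rank up to `d / 2`; pairs of odd blocks make up for the rounding. -/
theorem commutesWithSquareZero_of_two_mul_le_sum (S : Multiset ℕ) :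
    ∀ k, 2 * k ≤ S.sum → CommutesWithSquareZero F S k := by
  induction hn : S.card using Nat.strong_induction_on generalizing S with
  | _ n ih =>
    intro k hk
    -- Split off an even block.
    by_cases heven : ∃ d ∈ S, Even d
    · obtain ⟨d, hd, hd2⟩ := heven
      obtain ⟨T, rfl⟩ := Multiset.exists_cons_of_mem hd
      obtain ⟨c, rfl⟩ := hd2
      rw [Multiset.sum_cons] at hk
      rw [Multiset.card_cons] at hn
      have h1 : CommutesWithSquareZero F {c + c} (min k c) :=
        commutesWithSquareZero_singleton (by omega)
      have h2 : CommutesWithSquareZero F T (k - min k c) := ih _ (by omega) T rfl _ (by omega)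
      have := h1.add h2
      rwa [Nat.add_sub_cancel' (by omega), Multiset.singleton_add] at this
    · have hodd : ∀ d ∈ S, ∃ c, d = 2 * c + 1 := fun d hd =>
        Nat.not_even_iff_odd.1 fun h => heven ⟨d, hd, h⟩
      -- All blocks are odd: split off two of them, if there are two.
      rcases S.empty_or_exists_mem with rfl | ⟨d, hd⟩
      · obtain rfl : k = 0 := by simpa using hk
        refine ⟨PUnit, inferInstance, inferInstance, inferInstance, 0, 0, by simp, by simp,
          by simp, 0, rfl, by simp, ?_, finrank_zero_of_subsingleton⟩
        exact Subsingleton.elim _ _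
      · obtain ⟨T, rfl⟩ := Multiset.exists_cons_of_mem hd
        obtain ⟨a, rfl⟩ := hodd d hd
        rcases T.empty_or_exists_mem with rfl | ⟨d', hd'⟩
        · exact commutesWithSquareZero_singleton (by simpa using hk)
        · obtain ⟨U, rfl⟩ := Multiset.exists_cons_of_mem hd'
          obtain ⟨b, rfl⟩ := hodd d' (Multiset.mem_cons_of_mem hd')
          simp only [Multiset.sum_cons, Multiset.card_cons] at hk hn
          by_cases hk' : a + b + 1 ≤ k
          · have h1 : CommutesWithSquareZero F {2 * a + 1, 2 * b + 1} (a + b + 1) := by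
              rcases lt_trichotomy a b with h | rfl | h
              · rw [Multiset.pair_comm, add_comm a b]
                exact commutesWithSquareZero_pair_odd h
              · convert commutesWithSquareZero_pair_self (F := F) (2 * a + 1) using 1
                ring
              · exact commutesWithSquareZero_pair_odd h
            have h2 : CommutesWithSquareZero F U (k - (a + b + 1)) :=
              ih _ (by omega) U rfl _ (by omega)
            have := h1.add h2
            rwa [Nat.add_sub_cancel' hk', Multiset.insert_eq_cons, Multiset.cons_add,
              Multiset.singleton_add] at this
          · have h1 : CommutesWithSquareZero F {2 * a + 1} (min k a) :=
              commutesWithSquareZero_singleton (by omega)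
            have h2 : CommutesWithSquareZero F {2 * b + 1} (k - min k a) :=
              commutesWithSquareZero_singleton (by omega)
            have h3 : CommutesWithSquareZero F U 0 := ih _ (by omega) U rfl _ (by omega)
            have := h1.add (h2.add h3)
            rwa [add_zero, Nat.add_sub_cancel' (by omega), Multiset.singleton_add,
              Multiset.singleton_add] at this

/-! ### Square-zero matrices -/

/-- Nilpotency of the witness is automatic, because Jordan types are types of nilpotent maps. -/
theorem mem_commutatorPartitions_iff {n : ℕ} {B : Matrix (Fin n) (Fin n) F} {μ : n.Partition} :
    μ ∈ commutatorPartitions B ↔ ∃ A : End F (Fin n → F),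
      A * Matrix.toLin' B = Matrix.toLin' B * A ∧ HasJordanType A μ.parts := by
  constructor
  · rintro ⟨A, ⟨-, hAB⟩, hA⟩
    refine ⟨Matrix.toLin' A, ?_, (mem_nilpotentOrbit_iff μ A).1 hA⟩
    rw [Module.End.mul_eq_comp, Module.End.mul_eq_comp, ← Matrix.toLin'_mul, hAB,
      Matrix.toLin'_mul]
  · rintro ⟨A, hAB, hA⟩
    refine ⟨LinearMap.toMatrix' A, ⟨?_, ?_⟩, ?_⟩
    · rw [← Matrix.isNilpotent_toLin'_iff, Matrix.toLin'_toMatrix']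
      exact hA.isNilpotent
    · apply Matrix.toLin'.injective
      rw [Matrix.toLin'_mul, Matrix.toLin'_mul, Matrix.toLin'_toMatrix']
      exact hAB
    · rw [mem_nilpotentOrbit_iff, Matrix.toLin'_toMatrix']
      exact hA

/-- The square-zero endomorphism of rank `rank B` that commutes with a given Jordan type is similar
to `B`, and the similarity carries the Jordan type along. -/
theorem commutatorPartitions_eq_univ_of_sq_eq_zero {n : ℕ} {B : Matrix (Fin n) (Fin n) F}
    (hB : B ^ 2 = 0) : commutatorPartitions B = Set.univ := by
  refine Set.eq_univ_of_forall fun μ => ?_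
  have hN : (Matrix.toLin' B : End F (Fin n → F)) * Matrix.toLin' B = 0 := by
    rw [Module.End.mul_eq_comp, ← Matrix.toLin'_mul, ← pow_two, hB, map_zero]
  have hle : 2 * finrank F (LinearMap.range (Matrix.toLin' B)) ≤ μ.parts.sum := by
    have h1 : LinearMap.range (Matrix.toLin' B) ≤ LinearMap.ker (Matrix.toLin' B) := by
      rintro _ ⟨x, rfl⟩
      exact LinearMap.congr_fun hN x
    have h2 := Submodule.finrank_mono h1
    have h3 := LinearMap.finrank_range_add_finrank_ker (Matrix.toLin' B)
    rw [finrank_fin_fun] at h3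
    rw [μ.parts_sum]
    omega
  obtain ⟨V, _, _, _, A, N, hAN, hNN, hk, hA⟩ :=
    commutesWithSquareZero_of_two_mul_le_sum (F := F) μ.parts _ hle
  have hdim : finrank F V = finrank F (Fin n → F) := by
    obtain ⟨_, _, _, _, h⟩ := hA
    rw [h, μ.parts_sum, finrank_fin_fun]
  obtain ⟨φ, hφ⟩ := exists_linearEquiv_of_mul_self_eq_zero hNN hN hdim hk
  have hJ : HasJordanType (φ.conj A) μ.parts := hA.conj φ fun x => by simp
  refine mem_commutatorPartitions_iff.2 ⟨φ.conj A, LinearMap.ext fun x => ?_, hJ⟩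
  obtain ⟨y, rfl⟩ := φ.surjective x
  have := LinearMap.congr_fun hAN y
  simp only [Module.End.mul_apply] at this
  rw [Module.End.mul_apply, ← hφ, LinearEquiv.conj_apply_apply, φ.symm_apply_apply, this,
    Module.End.mul_apply, LinearEquiv.conj_apply_apply, φ.symm_apply_apply, hφ]

/-! ### Size three -/

theorem pow_finrank_eq_zero {V : Type*} [AddCommGroup V] [Module F V] [FiniteDimensional F V]
    {A : End F V} (hA : IsNilpotent A) : A ^ finrank F V = 0 := by
  have := LinearMap.aeval_self_charpoly A
  rwa [hA.charpoly_eq_X_pow_finrank, map_pow, aeval_X] at this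

theorem parts_of_three (μ : Nat.Partition 3) :
    μ.parts = {3} ∨ μ.parts = {2, 1} ∨ μ.parts = {1, 1, 1} := by
  have hsum := μ.parts_sum
  have hpos : ∀ i ∈ μ.parts, 0 < i := fun i hi => μ.parts_pos hi
  generalize μ.parts = S at hsum hpos
  rcases S.empty_or_exists_mem with rfl | ⟨a, ha⟩
  · simp at hsum
  obtain ⟨S, rfl⟩ := Multiset.exists_cons_of_mem ha
  have ha' := hpos a (by simp)
  rcases S.empty_or_exists_mem with rfl | ⟨b, hb⟩
  · left; simpa using hsum
  obtain ⟨S, rfl⟩ := Multiset.exists_cons_of_mem hb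
  have hb' := hpos b (by simp)
  rcases S.empty_or_exists_mem with rfl | ⟨c, hc⟩
  · right; left
    simp at hsum
    obtain ⟨rfl, rfl⟩ | ⟨rfl, rfl⟩ : (a = 2 ∧ b = 1) ∨ (a = 1 ∧ b = 2) := by omega
    · rfl
    · decide
  obtain ⟨S, rfl⟩ := Multiset.exists_cons_of_mem hc
  have hc' := hpos c (by simp)
  rcases S.empty_or_exists_mem with rfl | ⟨d, hd⟩
  · right; right
    simp at hsum
    obtain ⟨rfl, rfl, rfl⟩ : a = 1 ∧ b = 1 ∧ c = 1 := by omega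
    rfl
  obtain ⟨S, rfl⟩ := Multiset.exists_cons_of_mem hd
  have hd' := hpos d (by simp)
  simp at hsum
  omega

theorem linearIndependent_pow_apply {V : Type*} [AddCommGroup V] [Module F V] (A : End F V) (k : ℕ) :
    ∀ x : V, (A ^ k) x ≠ 0 → (A ^ (k + 1)) x = 0 →
      LinearIndependent F fun i : Fin (k + 1) => (A ^ (i : ℕ)) x := by
  induction k with
  | zero =>
    intro x hx _
    exact (linearIndependent_unique_iff (ι := Fin 1)).2 hx
  | succ k ih =>
    intro x hx hx0
    rw [linearIndependent_finSucc]
    refine ⟨ih (A x) hx hx0, fun hmem => hx ?_⟩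
    have hle : Submodule.span F (Set.range (Fin.tail fun i : Fin (k + 1 + 1) => (A ^ (i : ℕ)) x)) ≤
        LinearMap.ker (A ^ (k + 1)) := by
      rw [Submodule.span_le]
      rintro _ ⟨i, rfl⟩
      simp only [Fin.tail, SetLike.mem_coe, LinearMap.mem_ker, Fin.val_succ]
      rw [← Module.End.mul_apply, ← pow_add, show k + 1 + (i + 1) = i + (k + 1 + 1) by omega,
        pow_add, Module.End.mul_apply, hx0, map_zero]
    exact hle hmem

/-- A regular nilpotent `B` of size `3`, its square and zero realise the three partitions of `3`. -/
theorem commutatorPartitions_eq_univ_of_three {B : Matrix (Fin 3) (Fin 3) F} (hB : IsNilpotent B)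
    (hB2 : B ^ 2 ≠ 0) : commutatorPartitions B = Set.univ := by
  set N : End F (Fin 3 → F) := Matrix.toLin' B with hN
  have hN3 : N ^ 3 = 0 := by
    simpa using pow_finrank_eq_zero ((Matrix.isNilpotent_toLin'_iff B).2 hB)
  have hN2 : N ^ 2 ≠ 0 := by
    rw [hN, ← Matrix.toLin'_pow]
    exact fun h => hB2 (Matrix.toLin'.injective (h.trans (map_zero _).symm))
  obtain ⟨g, hg⟩ : ∃ g, (N ^ 2) g ≠ 0 := by
    by_contra! h
    exact hN2 (LinearMap.ext h)
  have hg3 : (N ^ 3) g = 0 := by rw [hN3, LinearMap.zero_apply]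
  have hli := linearIndependent_pow_apply N 2 g hg hg3
  have hspan : ∀ S : Submodule F (Fin 3 → F), g ∈ S → N g ∈ S → (N ^ 2) g ∈ S → S = ⊤ := by
    intro S h0 h1 h2
    rw [eq_top_iff, ← hli.span_eq_top_of_card_eq_finrank' (by simp), Submodule.span_le]
    rintro _ ⟨i, rfl⟩
    fin_cases i
    exacts [h0, by simpa using h1, h2]
  refine Set.eq_univ_of_forall fun μ => mem_commutatorPartitions_iff.2 ?_
  rcases parts_of_three μ with h | h | h <;> rw [h]
  · refine ⟨N, rfl, {(3, g)}, by simp, by simpa using hg3, hspan _ ?_ ?_ ?_, by simp⟩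
    · exact Submodule.subset_span ⟨(3, g), by simp, 0, by simp, rfl⟩
    · exact Submodule.subset_span ⟨(3, g), by simp, 1, by simp, by simp⟩
    · exact Submodule.subset_span ⟨(3, g), by simp, 2, by simp, rfl⟩
  · refine ⟨N ^ 2, by rw [← pow_succ, ← pow_succ'], {(2, g), (1, N g)}, by simp, ?_,
      hspan _ ?_ ?_ ?_, by simp⟩
    · intro p hp
      simp only [Multiset.insert_eq_cons, Multiset.mem_cons, Multiset.mem_singleton] at hp
      rcases hp with rfl | rfl
      · simp only
        rw [← pow_mul, show 2 * 2 = 1 + 3 by rfl, pow_add, hN3, mul_zero, LinearMap.zero_apply]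
      · simp only
        rw [pow_one, ← Module.End.mul_apply, ← pow_succ, hg3]
    · exact Submodule.subset_span ⟨(2, g), by simp, 0, by simp, rfl⟩
    · exact Submodule.subset_span ⟨(1, N g), by simp, 0, by simp, rfl⟩
    · exact Submodule.subset_span ⟨(2, g), by simp, 1, by simp, by simp⟩
  · refine ⟨0, by simp, {(1, g), (1, N g), (1, (N ^ 2) g)}, by simp, ?_,
      hspan _ ?_ ?_ ?_, by simp⟩
    · intro p hp
      simp only [Multiset.insert_eq_cons, Multiset.mem_cons, Multiset.mem_singleton] at hp
      rcases hp with rfl | rfl | rfl <;> simp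
    · exact Submodule.subset_span ⟨(1, g), by simp, 0, by simp, rfl⟩
    · exact Submodule.subset_span ⟨(1, N g), by simp, 0, by simp, rfl⟩
    · exact Submodule.subset_span ⟨(1, (N ^ 2) g), by simp, 0, by simp, rfl⟩

/-! ### Endomorphisms commuting with the types `(n)` and `(n - 1, 1)` -/

variable {V : Type*} [AddCommGroup V] [Module F V]

theorem commute_aeval_left {A N : End F V} (h : Commute A N) (p : F[X]) :
    Commute (aeval A p) N := by
  induction p using Polynomial.induction_on' with
  | add p q hp hq => rw [map_add]; exact hp.add_left hq
  | monomial n a =>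
    rw [aeval_monomial]
    exact Commute.mul_left (Algebra.commutes a N) (h.pow_left n)

theorem aeval_apply_of_apply_eq_zero {A : End F V} {y : V} (hy : A y = 0) (q : F[X]) :
    aeval A q y = q.coeff 0 • y := by
  conv_lhs => rw [← divX_mul_X_add q]
  simp [hy, Module.algebraMap_end_apply]

theorem exists_eq_X_pow_mul {p : F[X]} (hp : p ≠ 0) :
    ∃ (m : ℕ) (q : F[X]), p = X ^ m * q ∧ q.coeff 0 ≠ 0 := by
  obtain ⟨q, hq, hq0⟩ := exists_eq_pow_rootMultiplicity_mul_and_not_dvd p hp 0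
  rw [C_0, sub_zero] at hq hq0
  exact ⟨_, q, hq, fun h => hq0 (X_dvd_iff.2 h)⟩

theorem isUnit_aeval_of_coeff_zero_ne_zero {A : End F V} (hA : IsNilpotent A) {q : F[X]}
    (hq : q.coeff 0 ≠ 0) : IsUnit (aeval A q) := by
  rw [← divX_mul_X_add q, map_add, map_mul, aeval_X, aeval_C, add_comm]
  refine IsNilpotent.isUnit_add_left_of_commute ?_ ((isUnit_iff_ne_zero.2 hq).map _)
    (Algebra.commutes _ _).symm
  exact (commute_aeval_left (Commute.refl A) _).isNilpotent_mul_left hA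

theorem eq_zero_of_apply_eq_smul {N : End F V} (hN : IsNilpotent N) {x : V} {s : F}
    (h : N x = s • x) (hx : x ≠ 0) : s = 0 := by
  obtain ⟨k, hk⟩ := hN
  have hp : ∀ k, (N ^ k) x = s ^ k • x := by
    intro k
    induction k with
    | zero => simp
    | succ k ih => rw [pow_succ', Module.End.mul_apply, ih, map_smul, h, smul_smul, pow_succ]
  have := hp k
  rw [hk, LinearMap.zero_apply, eq_comm, smul_eq_zero] at this
  exact eq_zero_of_pow_eq_zero (this.resolve_right hx)

/-- An endomorphism commuting with a regular nilpotent `A` is a polynomial in `A`, hence a power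
`A ^ m` times an automorphism. -/
theorem HasJordanType.exists_finrank_range_eq_of_commute {A N : End F V} {n : ℕ}
    (hA : HasJordanType A {n}) (hcomm : Commute A N) (hN : N ^ 2 ≠ 0) :
    ∃ m, 2 * m < n ∧ finrank F (LinearMap.range N) = n - m ∧
      finrank F (LinearMap.range (N ^ 2)) = n - 2 * m := by
  obtain ⟨g, h0, hspan, hdim⟩ := hA.exists_cyclic
  obtain ⟨p, hp⟩ : ∃ p : F[X], N g = aeval A p g := by
    have hmem : N g ∈ Submodule.span F (Set.range fun i : Fin n => (A ^ (i : ℕ)) g) := by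
      rw [hspan]; trivial
    obtain ⟨c, hc⟩ := (Submodule.mem_span_range_iff_exists_fun F).1 hmem
    refine ⟨∑ i : Fin n, C (c i) * X ^ (i : ℕ), ?_⟩
    rw [← hc, map_sum, LinearMap.sum_apply]
    exact Finset.sum_congr rfl fun i _ => by simp [Module.algebraMap_end_apply]
  have hNp : N = aeval A p := by
    refine LinearMap.ext_on_range hspan fun i => ?_
    rw [← Module.End.mul_apply, ← (hcomm.pow_left i).eq, Module.End.mul_apply, hp,
      ← Module.End.mul_apply, ← Module.End.mul_apply,
      (commute_aeval_left ((Commute.refl A).pow_right i) p).eq]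
  have hp0 : p ≠ 0 := by
    rintro rfl
    exact hN (by rw [hNp]; simp)
  obtain ⟨m, q, rfl, hq⟩ := exists_eq_X_pow_mul hp0
  have hU := isUnit_aeval_of_coeff_zero_ne_zero hA.isNilpotent hq
  have hr : ∀ (k : ℕ) (U : End F V), IsUnit U → finrank F (LinearMap.range (A ^ k * U)) = n - k := by
    intro k U hU
    rw [Module.End.mul_eq_comp, LinearMap.range_comp_of_range_eq_top, hA.finrank_range_pow]
    exact LinearMap.range_eq_top.2 ((Module.End.isUnit_iff _).1 hU).2
  have hN1 : N = A ^ m * aeval A q := by rw [hNp, map_mul, map_pow, aeval_X]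
  have hN2 : N ^ 2 = A ^ (2 * m) * aeval A (q ^ 2) := by
    rw [hNp, ← map_pow, mul_pow, map_mul, map_pow, map_pow, aeval_X, ← pow_mul, mul_comm m]
  have hr2 : finrank F (LinearMap.range (N ^ 2)) = n - 2 * m := by
    rw [hN2]
    exact hr _ _ (by rw [map_pow]; exact hU.pow 2)
  refine ⟨m, ?_, by rw [hN1]; exact hr _ _ hU, hr2⟩
  by_contra hlt
  rw [Nat.sub_eq_zero_of_le (not_lt.1 hlt)] at hr2
  have : Module.Finite F V := by
    rcases Nat.eq_zero_or_pos n with rfl | hn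
    · have : Subsingleton V := by
        rw [← Submodule.subsingleton_iff F, ← subsingleton_iff_bot_eq_top, ← hspan]
        simp
      infer_instance
    · exact Module.finite_of_finrank_pos (by omega)
  exact hN (LinearMap.range_eq_bot.1 (Submodule.finrank_eq_zero.1 hr2))

theorem HasJordanType.exists_generators {A : End F V} {d : ℕ} (hA : HasJordanType A {d, 1}) :
    ∃ e f : V, (A ^ d) e = 0 ∧ A f = 0 ∧ finrank F V = d + 1 ∧
      Submodule.span F (Set.range fun i : Option (Fin d) => i.elim f fun i => (A ^ (i : ℕ)) e) =
        ⊤ := by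
  obtain ⟨G, hG, h0, hspan, hdim⟩ := hA
  obtain ⟨l, rfl, hl⟩ := exists_list_of_map_eq_coe Prod.fst [d, 1] G hG
  obtain ⟨e, l, rfl, rfl, hl'⟩ := List.map_eq_cons_iff.1 hl
  obtain ⟨f, l, rfl, hf, hl''⟩ := List.map_eq_cons_iff.1 hl'
  obtain rfl := List.map_eq_nil_iff.1 hl''
  refine ⟨e.2, f.2, h0 e (by simp), by simpa [hf] using h0 f (by simp), by simpa using hdim, ?_⟩
  rw [eq_top_iff, ← hspan, Submodule.span_le]
  rintro _ ⟨g, hg, j, hj, rfl⟩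
  simp only [Multiset.mem_coe, List.mem_cons, List.not_mem_nil, or_false] at hg
  rcases hg with rfl | rfl
  · exact Submodule.subset_span ⟨some ⟨j, hj⟩, rfl⟩
  · obtain rfl : j = 0 := by omega
    exact Submodule.subset_span ⟨none, rfl⟩

/-- On generators `e`, `f` of the two blocks, a commuting nilpotent `N` has the form
`N e = p(A) e + c f` and `N f = t A ^ (d - 1) e`. Let `m` be the order of `p` at zero. If
`m ≥ d - 1` (in particular if `p(A) = 0`), then `N` has rank at most `2`. Otherwise `N` has rank at
most `d - m`, which forces `m < m'`, and then `N ^ 2` has rank at least `d - 2 * m`. For the ranks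
in the hypotheses these bounds are incompatible. -/
theorem HasJordanType.false_of_commute {A N : End F V} {d m' : ℕ}
    (hA : HasJordanType A {d, 1}) (hd : 3 ≤ d) (hcomm : Commute A N) (hnil : IsNilpotent N)
    (hm' : 2 * m' < d + 1) (hr1 : finrank F (LinearMap.range N) = d + 1 - m')
    (hr2 : finrank F (LinearMap.range (N ^ 2)) = d + 1 - 2 * m') : False := by
  obtain ⟨e, f, he, hf, hdim, hspan⟩ := hA.exists_generators
  have : Module.Finite F V := Module.finite_of_finrank_pos (by omega)
  have hAN : ∀ i x, N ((A ^ i) x) = (A ^ i) (N x) := fun i x =>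
    (LinearMap.congr_fun (hcomm.pow_left i).eq x).symm
  have hpf : ∀ i, 0 < i → (A ^ i) f = 0 := by
    intro i hi
    obtain ⟨k, rfl⟩ : ∃ k, i = k + 1 := ⟨i - 1, by omega⟩
    rw [pow_succ, Module.End.mul_apply, hf, map_zero]
  have hz : (A ^ (d - 1)) e ≠ 0 := by
    have hli := linearIndependent_of_top_le_span_of_card_eq_finrank hspan.ge (by simp [hdim])
    exact hli.ne_zero (some ⟨d - 1, by omega⟩)
  have hAz : A ((A ^ (d - 1)) e) = 0 := by
    rw [← Module.End.mul_apply, ← pow_succ', Nat.sub_add_cancel (by omega), he]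
  have hep : ∀ i, d ≤ i → (A ^ i) e = 0 := by
    intro i hi
    obtain ⟨k, rfl⟩ := Nat.exists_eq_add_of_le' hi
    rw [pow_add, Module.End.mul_apply, he, map_zero]
  have hlead : ∀ (v : F[X]) (i : ℕ), d ≤ i + 1 →
      aeval A (v * X ^ i) e = v.coeff 0 • (A ^ i) e := by
    intro v i hi
    rw [map_mul, map_pow, aeval_X, Module.End.mul_apply, aeval_apply_of_apply_eq_zero]
    rw [← Module.End.mul_apply, ← pow_succ', hep _ hi]
  have hrep : ∀ x, ∃ (p : F[X]) (c : F), x = aeval A p e + c • f := by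
    intro x
    have hmem : x ∈ Submodule.span F
        (Set.range fun i : Option (Fin d) => i.elim f fun i => (A ^ (i : ℕ)) e) := by
      rw [hspan]; trivial
    obtain ⟨c, hc⟩ := (Submodule.mem_span_range_iff_exists_fun F).1 hmem
    refine ⟨∑ i : Fin d, C (c (some i)) * X ^ (i : ℕ), c none, ?_⟩
    rw [← hc, Fintype.sum_option, add_comm, map_sum, LinearMap.sum_apply]
    congr 1
    exact Finset.sum_congr rfl fun i _ => by simp [Module.algebraMap_end_apply]
  obtain ⟨p, c, hp⟩ := hrep (N e)
  have hNe : ∀ i, 0 < i → (A ^ i) (N e) = aeval A (p * X ^ i) e := by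
    intro i hi
    rw [hp, map_add, map_smul, hpf i hi, smul_zero, add_zero, mul_comm, map_mul, map_pow, aeval_X,
      Module.End.mul_apply]
  have hNf : ∃ t : F, N f = t • (A ^ (d - 1)) e := by
    obtain ⟨q, s, hq⟩ := hrep (N f)
    have hAq : A (aeval A q e) = 0 := by
      have h1 : A (N f) = 0 := by
        have := hAN 1 f
        rwa [pow_one, hf, map_zero, eq_comm] at this
      rwa [hq, map_add, map_smul, hf, smul_zero, add_zero] at h1
    obtain ⟨t, ht⟩ : ∃ t : F, aeval A q e = t • (A ^ (d - 1)) e := by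
      by_cases hq0 : q = 0
      · exact ⟨0, by simp [hq0]⟩
      obtain ⟨l, v, rfl, hv⟩ := exists_eq_X_pow_mul hq0
      have hl : d ≤ l + 1 := by
        by_contra hlt
        have h1 : (A ^ (d - 1 - l)) (aeval A (X ^ l * v) e) = 0 := by
          obtain ⟨k, hk⟩ : ∃ k, d - 1 - l = k + 1 := ⟨d - 2 - l, by omega⟩
          rw [hk, pow_succ, Module.End.mul_apply, hAq, map_zero]
        have h2 : (A ^ (d - 1 - l)) (aeval A (X ^ l * v) e) = v.coeff 0 • (A ^ (d - 1)) e := by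
          rw [← hlead v (d - 1) (by omega), ← Module.End.mul_apply]
          congr 1
          rw [show A ^ (d - 1 - l) = aeval A (X ^ (d - 1 - l) : F[X]) by simp, ← map_mul]
          congr 1
          rw [← mul_assoc, ← pow_add, Nat.sub_add_cancel (by omega), mul_comm]
        exact smul_ne_zero hv hz (h2.symm.trans h1)
      rw [mul_comm, hlead v l hl]
      rcases hl.eq_or_lt with h | h
      · exact ⟨_, by rw [h, Nat.add_sub_cancel]⟩
      · exact ⟨0, by rw [hep l (by omega), smul_zero, zero_smul]⟩
    have hNz : N ((A ^ (d - 1)) e) = 0 := by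
      have h1 : N ((A ^ (d - 1)) e) = p.coeff 0 • (A ^ (d - 1)) e := by
        rw [hAN, hNe _ (by omega), hlead p _ (by omega)]
      rw [h1, eq_zero_of_apply_eq_smul hnil h1 hz, zero_smul]
    -- Since `N (N f) = s • N f`, nilpotency leaves `s = 0` or `N f = 0`.
    by_cases hNf0 : N f = 0
    · exact ⟨0, by rw [hNf0, zero_smul]⟩
    · have hs : s = 0 := by
        refine eq_zero_of_apply_eq_smul hnil (x := N f) ?_ hNf0
        conv_lhs => rw [hq, ht, map_add, map_smul, map_smul, hNz, smul_zero, zero_add]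
      exact ⟨t, by rw [hq, ht, hs, zero_smul, add_zero]⟩
  obtain ⟨t, ht⟩ := hNf
  have hrange : ∀ S : Submodule F V, N f ∈ S → (∀ i, (A ^ i) (N e) ∈ S) →
      LinearMap.range N ≤ S := by
    intro S h1 h2
    rw [LinearMap.range_eq_map, ← hspan, Submodule.map_span, Submodule.span_le]
    rintro _ ⟨_, ⟨_ | i, rfl⟩, rfl⟩
    · exact h1
    · simp only [Option.elim_some, hAN]
      exact h2 i
  by_cases hsmall : A (N e) = 0
  · -- The range of `N` is spanned by `N e` and `N f`.
    have hle : LinearMap.range N ≤ Submodule.span F (Set.range ![N e, N f]) := by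
      refine hrange _ (Submodule.subset_span ⟨1, rfl⟩) fun i => ?_
      rcases Nat.eq_zero_or_pos i with rfl | hi
      · exact Submodule.subset_span ⟨0, rfl⟩
      · obtain ⟨k, rfl⟩ : ∃ k, i = k + 1 := ⟨i - 1, by omega⟩
        rw [pow_succ, Module.End.mul_apply, hsmall, map_zero]
        exact Submodule.zero_mem _
    have h1 := (Submodule.finrank_mono hle).trans (finrank_range_le_card ![N e, N f])
    simp only [Fintype.card_fin] at h1
    omega
  · have hp0 : p ≠ 0 := by
      rintro rfl
      have := hNe 1 one_pos
      rw [pow_one, zero_mul, map_zero, LinearMap.zero_apply] at this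
      exact hsmall this
    obtain ⟨m, u, rfl, hu⟩ := exists_eq_X_pow_mul hp0
    have hNe' : ∀ i, 0 < i → d ≤ m + i + 1 →
        (A ^ i) (N e) = u.coeff 0 • (A ^ (m + i)) e := by
      intro i hi hd
      rw [hNe i hi, ← hlead u _ hd]
      congr 2
      ring
    have hm : m + 2 ≤ d := by
      by_contra hlt
      apply hsmall
      have := hNe' 1 one_pos (by omega)
      rwa [pow_one, hep _ (by omega), smul_zero] at this
    have hle : LinearMap.range N ≤
        Submodule.span F (Set.range fun i : Fin (d - m) => (A ^ (i : ℕ)) (N e)) := by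
      refine hrange _ ?_ fun i => ?_
      · have h1 := hNe' (d - 1 - m) (by omega) (by omega)
        rw [show m + (d - 1 - m) = d - 1 by omega] at h1
        have h2 : N f = (t * (u.coeff 0)⁻¹) • (A ^ (d - 1 - m)) (N e) := by
          rw [h1, ht, smul_smul, mul_assoc, inv_mul_cancel₀ hu, mul_one]
        rw [h2]
        exact Submodule.smul_mem _ _ (Submodule.subset_span ⟨⟨d - 1 - m, by omega⟩, rfl⟩)
      · by_cases hi : i < d - m
        · exact Submodule.subset_span ⟨⟨i, hi⟩, rfl⟩
        · rw [hNe' i (by omega) (by omega), hep _ (by omega), smul_zero]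
          exact Submodule.zero_mem _
    have h1 := (Submodule.finrank_mono hle).trans (finrank_range_le_card _)
    rw [Fintype.card_fin, hr1] at h1
    -- Hence `m < m'` and the exponent below is positive.
    obtain ⟨k, hk⟩ : ∃ k, d - 1 = 2 * m + k := ⟨d - 1 - 2 * m, by omega⟩
    have hk0 : 0 < k := by omega
    have hNN : (A ^ k) ((N ^ 2) e) = (u.coeff 0 * u.coeff 0) • (A ^ (d - 1)) e := by
      have h2 : (A ^ k) (N f) = 0 := by rw [← hAN, hpf k hk0, map_zero]
      have h3 : N (aeval A (X ^ m * u) e) = aeval A (X ^ m * u) (N e) :=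
        (LinearMap.congr_fun (commute_aeval_left hcomm _).eq e).symm
      have h4 : (A ^ k) (aeval A (X ^ m * u) (N e)) = aeval A (X ^ m * u) ((A ^ k) (N e)) :=
        (LinearMap.congr_fun (commute_aeval_left ((Commute.refl A).pow_right k) _).eq _).symm
      rw [pow_two N, Module.End.mul_apply, hp, map_add, map_smul, map_add, map_smul, h2, smul_zero,
        add_zero, h3, h4, hNe k hk0, ← Module.End.mul_apply, ← map_mul, ← mul_coeff_zero,
        ← hlead _ _ (by omega), hk]
      congr 2
      ring
    have hli := linearIndependent_pow_apply A k ((N ^ 2) e)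
      (by rw [hNN]; exact smul_ne_zero (mul_ne_zero hu hu) hz)
      (by rw [pow_succ', Module.End.mul_apply, hNN, map_smul, hAz, smul_zero])
    have hle2 : Submodule.span F (Set.range fun i : Fin (k + 1) => (A ^ (i : ℕ)) ((N ^ 2) e)) ≤
        LinearMap.range (N ^ 2) := by
      rw [Submodule.span_le]
      rintro _ ⟨i, rfl⟩
      exact ⟨(A ^ (i : ℕ)) e, (LinearMap.congr_fun ((hcomm.pow_left i).pow_right 2).eq e).symm⟩
    have h5 := Submodule.finrank_mono hle2
    rw [finrank_span_eq_card hli, Fintype.card_fin, hr2] at h5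
    omega

/-- The Jordan types `(n)` and `(n - 1, 1)` cannot both occur in the nilpotent commutator of `B`
unless `B ^ 2 = 0`. -/
theorem sq_eq_zero_of_commutatorPartitions_eq_univ {n : ℕ} (hn : 4 ≤ n)
    {B : Matrix (Fin n) (Fin n) F} (hB : IsNilpotent B) (h : commutatorPartitions B = Set.univ) :
    B ^ 2 = 0 := by
  by_contra hB2
  have hN2 : (Matrix.toLin' B : End F (Fin n → F)) ^ 2 ≠ 0 := by
    rw [← Matrix.toLin'_pow]
    exact fun h => hB2 (Matrix.toLin'.injective (h.trans (map_zero _).symm))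
  have hall : ∀ μ : n.Partition, μ ∈ commutatorPartitions B := by simp [h]
  obtain ⟨A, hAB, hA⟩ := mem_commutatorPartitions_iff.1 (hall
    { parts := {n}, parts_pos := fun {i} hi => by simp at hi; omega, parts_sum := by simp })
  obtain ⟨m, hm, h1, h2⟩ := hA.exists_finrank_range_eq_of_commute hAB hN2
  obtain ⟨A', hAB', hA'⟩ := mem_commutatorPartitions_iff.1 (hall
    { parts := {n - 1, 1}, parts_pos := fun {i} hi => by simp at hi; omega,
      parts_sum := by simp; omega })
  exact hA'.false_of_commute (m' := m) (by omega) hAB' ((Matrix.isNilpotent_toLin'_iff B).2 hB)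
    (by omega) (by rw [h1]; congr 1; omega) (by rw [h2]; congr 1; omega)

end

end NilpotentCommutator

theorem mainTheorem1 {F : Type*} [Field F] [IsAlgClosed F] [CharZero F] (n : ℕ)
    (B : Matrix (Fin n) (Fin n) F) (hB : IsNilpotent B) :
    (n ≤ 3 → NilpotentCommutator.commutatorPartitions B = Set.univ) ∧
    (4 ≤ n → (NilpotentCommutator.commutatorPartitions B = Set.univ ↔ B ^ 2 = 0)) := by
  refine ⟨fun hn => ?_, fun hn =>
    ⟨NilpotentCommutator.sq_eq_zero_of_commutatorPartitions_eq_univ hn hB,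
      NilpotentCommutator.commutatorPartitions_eq_univ_of_sq_eq_zero⟩⟩
  by_cases hB2 : B ^ 2 = 0
  · exact NilpotentCommutator.commutatorPartitions_eq_univ_of_sq_eq_zero hB2
  · obtain rfl : n = 3 := by
      by_contra hn3
      have h1 := NilpotentCommutator.pow_finrank_eq_zero
        ((Matrix.isNilpotent_toLin'_iff B).2 hB)
      rw [Module.finrank_fin_fun, ← Matrix.toLin'_pow] at h1
      have h2 : B ^ n = 0 := Matrix.toLin'.injective (h1.trans (map_zero _).symm)
      exact hB2 (pow_eq_zero_of_le (by omega) h2)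
    exact NilpotentCommutator.commutatorPartitions_eq_univ_of_three hB hB2
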